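/- Let $T\in\mathbb N$ and consider the linear-Gaussian system, for $x_t\in\mathbb R^n$, $u_t\in\mathbb R^m$, $y_t\in\mathbb R^l$, $$x_{t+1}=A_tx_t+B_tu_t+\epsilon_t,\qquad y_t=D_tx_t+\omega_t,\qquad x_0\sim N(\bar x_0,\Sigma_{x_0}),\ \epsilon_t\sim N(0,\Sigma_{\epsilon_t}),\ \omega_t\sim N(0,\Sigma_{\omega_t}),$$ together with task-relevant variables (TRVs) $\tilde x_t\in\mathbb R^k$ and a policy $$\tilde x_t=C_tx_t+a_t+\eta_t,\quad \eta_t\sim N(0,\Sigma_{\eta_t}),\qquad u_t=K_t\tilde x_t+h_t,$$ where all noises and $x_0$ are independent, $\Sigma_{x_0}$ and $\Sigma_{\epsilon_t}$ ($t<T$) are positive semidefinite, and $\Sigma_{\eta_t}$ and $\Sigma_{\omega_t}$ ($t\le T$) are positive definite. Let $p_t(x_t)$ and $q_t(\tilde x_t)$ be the laws of $x_t$ and $\tilde x_t$ under this policy, let $\bar x_t,\Sigma_{x_t}$ be the mean and covariance of $p_t$, and put $\bar{\tilde x}_t=C_t\bar x_t+a_t$, $\Sigma_{\tilde x_t}=C_t\Sigma_{x_t}C_t^{\mathsf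 T}+\Sigma_{\eta_t}$. The Bayes filter on the TRVs uses $p_t(x_t|\tilde x_t)=q_t(\tilde x_t|x_t)p_t(x_t)/q_t(\tilde x_t)$ and the models $$q_t(\tilde x_{t+1}|\tilde x_t,u_t)=\iint q_{t+1}(\tilde x_{t+1}|x_{t+1})\,p_t(x_{t+1}|u_t,x_t)\,p_t(x_t|\tilde x_t)\,dx_t\,dx_{t+1},\qquad \sigma_t(y_t|\tilde x_t)=\int\sigma_t(y_t|x_t)\,p_t(x_t|\tilde x_t)\,dx_t .$$ Here $q_t(\cdot|x_t)$, $p_t(\cdot|u_t,x_t)$ and $\sigma_t(\cdot|x_t)$ are the conditional laws given by the TRV, state and sensor equations above, and integrals against singular Gaussian laws are integrals against measures. Starting from $\overline{\mathrm{bel}}(\tilde x_0)=q_0(\tilde x_0)$, for given inputs $u_0,u_1,\dots$ and measurements $y_0,y_1,\dots$ the filter alternates the measurement update $\mathrm{bel}(\tilde x_t)\propto\sigma_t(y_t|\tilde x_t)\,\overline{\mathrm{bel}}(\tilde x_t)$ and the process update $\overline{\mathrm{bel}}(\tilde x_{t+1})=\int q_t(\tilde x_{t+1}|\tilde x_t,u_t)\,\mathrm{bel}(\tilde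 x_t)\,d\tilde x_t$. Then, for $t\le T$, $p_t=N(\bar x_t,\Sigma_{x_t})$; $q_t=N(\bar{\tilde x}_t,\Sigma_{\tilde x_t})$ with $\Sigma_{\tilde x_t}$ positive definite; and $x_t|\tilde x_t\sim N(\mu_{x_t|\tilde x_t},\Sigma_{x_t|\tilde x_t})$ with $$\mu_{x_t|\tilde x_t}=\bar x_t+\Sigma_{x_t}C_t^{\mathsf T}\Sigma_{\tilde x_t}^{-1}(\tilde x_t-\bar{\tilde x}_t),\qquad \Sigma_{x_t|\tilde x_t}=\Sigma_{x_t}-\Sigma_{x_t}C_t^{\mathsf T}\Sigma_{\tilde x_t}^{-1}C_t\Sigma_{x_t}.$$ Moreover, the models $q_t(\tilde x_{t+1}|\tilde x_t,u_t)$ ($t<T$) and $\sigma_t(y_t|\tilde x_t)$ ($t\le T$), the latter with the output written as $\tilde y_t:=y_t-D_t\bar x_t+\tilde D_t\bar{\tilde x}_t$, are exactly the transition and output laws of the linear-Gaussian system $$\tilde x_{t+1}=\tilde A_t\tilde x_t+\tilde B_tu_t+\tilde r_t+\tilde\epsilon_t,\qquad \tilde y_t=\tilde D_t\tilde x_t+\tilde\omega_t,\qquad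 \tilde x_0\sim N(\bar{\tilde x}_0,\Sigma_{\tilde x_0}),$$ with independent noises $\tilde\epsilon_t\sim N(0,\Sigma_{\tilde x_{t+1}|\tilde x_t,u_t})$, $\tilde\omega_t\sim N(0,\Sigma_{y_t|\tilde x_t})$ of positive definite covariance, where $$\tilde A_t=C_{t+1}A_t\Sigma_{x_t}C_t^{\mathsf T}\Sigma_{\tilde x_t}^{-1},\quad \tilde B_t=C_{t+1}B_t,\quad \tilde D_t=D_t\Sigma_{x_t}C_t^{\mathsf T}\Sigma_{\tilde x_t}^{-1},\quad \tilde r_t=-\tilde A_t\bar{\tilde x}_t+C_{t+1}A_t\bar x_t+a_{t+1},$$ $$\Sigma_{\tilde x_{t+1}|\tilde x_t,u_t}=C_{t+1}\big(A_t\Sigma_{x_t|\tilde x_t}A_t^{\mathsf T}+\Sigma_{\epsilon_t}\big)C_{t+1}^{\mathsf T}+\Sigma_{\eta_{t+1}},\qquad \Sigma_{y_t|\tilde x_t}=D_t\Sigma_{x_t|\tilde x_t}D_t^{\mathsf T}+\Sigma_{\omega_t}.$$ Finally, the Bayes filter is the Kalman filter of this system: applied to any Gaussian belief $N(\mu,P)$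 (with $P$ positive semidefinite), the process update with input $u$ ($t<T$) yields $$N\big(\tilde A_t\mu+\tilde B_tu+\tilde r_t,\ \tilde A_tP\tilde A_t^{\mathsf T}+\Sigma_{\tilde x_{t+1}|\tilde x_t,u_t}\big),$$ and the measurement update with $y_t$ ($t\le T$) yields $$N\big(\mu+L_t(\tilde y_t-\tilde D_t\mu),\ (I-L_t\tilde D_t)P\big),\qquad L_t=P\tilde D_t^{\mathsf T}\big(\tilde D_tP\tilde D_t^{\mathsf T}+\Sigma_{y_t|\tilde x_t}\big)^{-1};$$ consequently, for all inputs and measurements and all $t\le T$, $\overline{\mathrm{bel}}(\tilde x_t)$ and $\mathrm{bel}(\tilde x_t)$ are the Gaussian laws whose means and covariances are those computed by this Kalman filter started at $(\bar{\tilde x}_0,\Sigma_{\tilde x_0})$. -/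

import Mathlib

open MeasureTheory ProbabilityTheory
open scoped ENNReal Matrix

noncomputable section

/-- `ℝᵈ` as a Euclidean space. -/
abbrev Vec (d : ℕ) : Type := EuclideanSpace ℝ (Fin d)

/-- Matrix-vector multiplication on Euclidean spaces. -/
abbrev matVec {p q : ℕ} (A : Matrix (Fin p) (Fin q) ℝ) (x : Vec q) : Vec p :=
  Matrix.toEuclideanLin A x

infixr:73 " ⬝ₑ " => matVec

/-- Density at `x` (with respect to Lebesgue measure on `ℝᵈ`) of the Gaussian law `N(μ, S)`,
for a positive definite covariance matrix `S`. -/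
def gaussianDensity {d : ℕ} (μ : Vec d) (S : Matrix (Fin d) (Fin d) ℝ) (x : Vec d) : ℝ≥0∞ :=
  ENNReal.ofReal ((√((2 * Real.pi) ^ d * S.det))⁻¹ *
    Real.exp (-(1 / 2) * ((x - μ : Vec d).ofLp ⬝ᵥ S⁻¹ *ᵥ (x - μ : Vec d).ofLp)))

/-- Mean vector of a law on `ℝᵈ`. -/
def meanVec {d : ℕ} (μ : Measure (Vec d)) : Vec d := ∫ x, x ∂μ

/-- Covariance matrix of a law on `ℝᵈ`. -/
def covMat {d : ℕ} (μ : Measure (Vec d)) : Matrix (Fin d) (Fin d) ℝ :=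
  Matrix.of fun i j => cov[fun x : Vec d => x i, fun x : Vec d => x j; μ]

/-- Bayes' rule: the probability measure proportional to `likelihood × prior`. -/
def bayesRule {α : Type*} [MeasurableSpace α] (prior : Measure α) (likelihood : α → ℝ≥0∞) :
    Measure α :=
  (∫⁻ a, likelihood a ∂prior)⁻¹ • prior.withDensity likelihood

/-! ### Linear-Gaussian systems and the Kalman filter -/

/-- A (time-varying, partially observed) linear-Gaussian system
`x_{t+1} = A_t x_t + B_t u_t + r_t + ε_t`, `y_t = D_t x_t + ω_t` with independent
`x_0 ∼ N(m0, P0)`, `ε_t ∼ N(0, Q_t)`, `ω_t ∼ N(0, R_t)`. -/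
structure LGSystem (n m l : ℕ) where
  A : ℕ → Matrix (Fin n) (Fin n) ℝ
  B : ℕ → Matrix (Fin n) (Fin m) ℝ
  r : ℕ → Vec n
  Q : ℕ → Matrix (Fin n) (Fin n) ℝ
  D : ℕ → Matrix (Fin l) (Fin n) ℝ
  R : ℕ → Matrix (Fin l) (Fin l) ℝ
  m0 : Vec n
  P0 : Matrix (Fin n) (Fin n) ℝ

namespace LGSystem

variable {n m l : ℕ} (S : LGSystem n m l)

/-- Transition law of the next state, given the present state `x` and input `u`. -/
def trans (t : ℕ) (u : Vec m) (x : Vec n) : Measure (Vec n) :=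
  multivariateGaussian (S.A t ⬝ₑ x + S.B t ⬝ₑ u + S.r t) (S.Q t)

/-- Density at `y` of the output, given the present state `x`. -/
def sensorDensity (t : ℕ) (x : Vec n) (y : Vec l) : ℝ≥0∞ :=
  gaussianDensity (S.D t ⬝ₑ x) (S.R t) y

/-- Kalman process update `(mean, covariance) ↦ (predicted mean, predicted covariance)`. -/
def kalmanPredict (t : ℕ) (u : Vec m) (b : Vec n × Matrix (Fin n) (Fin n) ℝ) :
    Vec n × Matrix (Fin n) (Fin n) ℝ :=
  (S.A t ⬝ₑ b.1 + S.B t ⬝ₑ u + S.r t, S.A t * b.2 * (S.A t)ᵀ + S.Q t)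

/-- Kalman gain for the predicted covariance `P`. -/
def kalmanGain (t : ℕ) (P : Matrix (Fin n) (Fin n) ℝ) : Matrix (Fin n) (Fin l) ℝ :=
  P * (S.D t)ᵀ * (S.D t * P * (S.D t)ᵀ + S.R t)⁻¹

/-- Kalman measurement update with the output `y`. -/
def kalmanMeasurement (t : ℕ) (y : Vec l) (b : Vec n × Matrix (Fin n) (Fin n) ℝ) :
    Vec n × Matrix (Fin n) (Fin n) ℝ :=
  (b.1 + S.kalmanGain t b.2 ⬝ₑ (y - S.D t ⬝ₑ b.1), (1 - S.kalmanGain t b.2 * S.D t) * b.2)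

/-- Mean and covariance of the Kalman filter at time `t` before `y t` is used. -/
def kalmanPrior (u : ℕ → Vec m) (y : ℕ → Vec l) : ℕ → Vec n × Matrix (Fin n) (Fin n) ℝ
  | 0 => (S.m0, S.P0)
  | t + 1 => S.kalmanPredict t (u t) (S.kalmanMeasurement t (y t) (kalmanPrior u y t))

/-- Mean and covariance of the Kalman filter at time `t` after `y t` has been used. -/
def kalmanPosterior (u : ℕ → Vec m) (y : ℕ → Vec l) (t : ℕ) : Vec n × Matrix (Fin n) (Fin n) ℝ :=
  S.kalmanMeasurement t (y t) (S.kalmanPrior u y t)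

end LGSystem

/-! ### Linear-Gaussian systems with task-relevant variables -/

/-- The data of the linear-Gaussian case, with state in `ℝⁿ`, input in `ℝᵐ`, task-relevant
variables (TRVs) in `ℝᵏ` and output in `ℝˡ`:
`x_{t+1} = A_t x_t + B_t u_t + ε_t`, `x_0 ∼ N(meanX0, covX0)`, `ε_t ∼ N(0, covEps_t)` (dynamics);
`y_t = D_t x_t + ω_t`, `ω_t ∼ N(0, covOmega_t)` (sensor);
`z_t = C_t x_t + a_t + η_t`, `η_t ∼ N(0, covEta_t)` (TRVs);
`u_t = K_t z_t + h_t` (policy). -/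
structure TRVModel (n m k l : ℕ) where
  meanX0 : Vec n
  covX0 : Matrix (Fin n) (Fin n) ℝ
  A : ℕ → Matrix (Fin n) (Fin n) ℝ
  B : ℕ → Matrix (Fin n) (Fin m) ℝ
  covEps : ℕ → Matrix (Fin n) (Fin n) ℝ
  D : ℕ → Matrix (Fin l) (Fin n) ℝ
  covOmega : ℕ → Matrix (Fin l) (Fin l) ℝ
  C : ℕ → Matrix (Fin k) (Fin n) ℝ
  a : ℕ → Vec k
  covEta : ℕ → Matrix (Fin k) (Fin k) ℝ
  K : ℕ → Matrix (Fin m) (Fin k) ℝ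
  h : ℕ → Vec m

namespace TRVModel

variable {n m k l : ℕ} (M : TRVModel n m k l)

/-- `p_t(x_{t+1} | u_t, x_t)`. -/
def dynamics (t : ℕ) (u : Vec m) (x : Vec n) : Measure (Vec n) :=
  multivariateGaussian (M.A t ⬝ₑ x + M.B t ⬝ₑ u) (M.covEps t)

/-- `q_t(z_t | x_t)`, as a law. -/
def encoder (t : ℕ) (x : Vec n) : Measure (Vec k) :=
  multivariateGaussian (M.C t ⬝ₑ x + M.a t) (M.covEta t)

/-- `q_t(z_t | x_t)`, as a density. -/
def encoderDensity (t : ℕ) (x : Vec n) (z : Vec k) : ℝ≥0∞ :=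
  gaussianDensity (M.C t ⬝ₑ x + M.a t) (M.covEta t) z

/-- `σ_t(y_t | x_t)`, as a density. -/
def sensorDensity (t : ℕ) (x : Vec n) (y : Vec l) : ℝ≥0∞ :=
  gaussianDensity (M.D t ⬝ₑ x) (M.covOmega t) y

/-- `p_t(x_t)`: the law of the state under the policy `u_t = K_t z_t + h_t`. -/
def stateLaw : ℕ → Measure (Vec n)
  | 0 => multivariateGaussian M.meanX0 M.covX0
  | t + 1 => (stateLaw t).bind fun x =>
      (M.encoder t x).bind fun z => M.dynamics t (M.K t ⬝ₑ z + M.h t) x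

/-- `q_t(z_t)`: the law of the TRV under the policy. -/
def trvLaw (t : ℕ) : Measure (Vec k) := (M.stateLaw t).bind (M.encoder t)

/-- `x̄_t`. -/
def stateMean (t : ℕ) : Vec n := meanVec (M.stateLaw t)

/-- `Σ_{x_t}`. -/
def stateCov (t : ℕ) : Matrix (Fin n) (Fin n) ℝ := covMat (M.stateLaw t)

/-- The mean `C_t x̄_t + a_t` of the TRV. -/
def trvMean (t : ℕ) : Vec k := M.C t ⬝ₑ M.stateMean t + M.a t

/-- The covariance `C_t Σ_{x_t} C_tᵀ + Σ_{η_t}` of the TRV. -/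
def trvCov (t : ℕ) : Matrix (Fin k) (Fin k) ℝ := M.C t * M.stateCov t * (M.C t)ᵀ + M.covEta t

/-! #### The Bayes filter on the TRVs -/

/-- `p_t(x_t | z_t) = q_t(z_t | x_t) p_t(x_t) / q_t(z_t)`. -/
def stateGivenTRV (t : ℕ) (z : Vec k) : Measure (Vec n) :=
  bayesRule (M.stateLaw t) fun x => M.encoderDensity t x z

/-- `p_t(x_{t+1} | z_t, u_t)`. -/
def nextStateGivenTRV (t : ℕ) (u : Vec m) (z : Vec k) : Measure (Vec n) :=
  (M.stateGivenTRV t z).bind (M.dynamics t u)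

/-- `q_t(z_{t+1} | z_t, u_t)`. -/
def nextTRVGivenTRV (t : ℕ) (u : Vec m) (z : Vec k) : Measure (Vec k) :=
  (M.nextStateGivenTRV t u z).bind (M.encoder (t + 1))

/-- `σ_t(y_t | z_t)`, as a density. -/
def sensorGivenTRV (t : ℕ) (z : Vec k) (y : Vec l) : ℝ≥0∞ :=
  ∫⁻ x, M.sensorDensity t x y ∂(M.stateGivenTRV t z)

/-- Process update, from a belief on `z_t` to a belief on `z_{t+1}`. -/
def bayesPredict (t : ℕ) (u : Vec m) (bel : Measure (Vec k)) : Measure (Vec k) :=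
  bel.bind (M.nextTRVGivenTRV t u)

/-- Measurement update of a belief on `z_t` with the output `y`. -/
def bayesMeasurement (t : ℕ) (y : Vec l) (bel : Measure (Vec k)) : Measure (Vec k) :=
  bayesRule bel fun z => M.sensorGivenTRV t z y

/-- Belief on `z_t` before `y t` is used. -/
def belPrior (u : ℕ → Vec m) (y : ℕ → Vec l) : ℕ → Measure (Vec k)
  | 0 => M.trvLaw 0
  | t + 1 => M.bayesPredict t (u t) (M.bayesMeasurement t (y t) (belPrior u y t))

/-- Belief on `z_t` after `y t` has been used. -/
def belPosterior (u : ℕ → Vec m) (y : ℕ → Vec l) (t : ℕ) : Measure (Vec k) :=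
  M.bayesMeasurement t (y t) (M.belPrior u y t)

/-! #### The induced linear-Gaussian system -/

/-- `μ_{x_t | z_t}`. -/
def condMean (t : ℕ) (z : Vec k) : Vec n :=
  M.stateMean t + (M.stateCov t * (M.C t)ᵀ * (M.trvCov t)⁻¹) ⬝ₑ (z - M.trvMean t)

/-- `Σ_{x_t | z_t}`. -/
def condCov (t : ℕ) : Matrix (Fin n) (Fin n) ℝ :=
  M.stateCov t - M.stateCov t * (M.C t)ᵀ * (M.trvCov t)⁻¹ * M.C t * M.stateCov t

/-- The state matrix `C_{t+1} A_t Σ_{x_t} C_tᵀ Σ_{z_t}⁻¹`. -/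
def indA (t : ℕ) : Matrix (Fin k) (Fin k) ℝ :=
  M.C (t + 1) * M.A t * M.stateCov t * (M.C t)ᵀ * (M.trvCov t)⁻¹

/-- The output matrix `D_t Σ_{x_t} C_tᵀ Σ_{z_t}⁻¹`. -/
def indD (t : ℕ) : Matrix (Fin l) (Fin k) ℝ :=
  M.D t * M.stateCov t * (M.C t)ᵀ * (M.trvCov t)⁻¹

/-- The linear-Gaussian system induced on the TRV-space. -/
def induced : LGSystem k m l where
  A := M.indA
  B t := M.C (t + 1) * M.B t
  r t := -(M.indA t ⬝ₑ M.trvMean t) + (M.C (t + 1) * M.A t) ⬝ₑ M.stateMean t + M.a (t + 1)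
  Q t := M.C (t + 1) * (M.A t * M.condCov t * (M.A t)ᵀ + M.covEps t) * (M.C (t + 1))ᵀ + M.covEta (t + 1)
  D := M.indD
  R t := M.D t * M.condCov t * (M.D t)ᵀ + M.covOmega t
  m0 := M.trvMean 0
  P0 := M.trvCov 0

/-- The output of the induced system: `y_t` after the change of variables
`y ↦ y - D_t x̄_t + D̃_t z̄_t`. -/
def inducedOutput (t : ℕ) (y : Vec l) : Vec l :=
  y - M.D t ⬝ₑ M.stateMean t + M.indD t ⬝ₑ M.trvMean t

end TRVModel

end

/-! ### Matrix-vector multiplication on Euclidean spaces -/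

/-! Every law in the filter comes from two operations that keep Gaussian laws Gaussian, and the
theorem is the bookkeeping of their parameters.

Mixing: a Gaussian mixture of Gaussians whose mean is affine in the mixing variable is Gaussian,
since it is the law of an affine image plus independent noise (`bind_multivariateGaussian`, by
characteristic functions). This covers the state law, the TRV law, the transition model and the
process update.

Conditioning: reweighting `N(μ, P)` by a linear-Gaussian likelihood gives the evidence times the
posterior (`multivariateGaussian_withDensity_gaussianDensity`). It yields the law of the state given
the TRV, the sensor model and the measurement update. As `P` may be singular there need not be a
prior density; so `N(μ, P)` is written as the image of the standard Gaussian under `w ↦ √P w + μ`,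
the square is completed in `w`, and the result is pushed forward.

The conditional mean of the state is affine in the TRV, with covariance independent of it, so the
induced models are again linear-Gaussian. Applying the same two operations to them gives the Kalman
updates, and induction on time finishes. -/

lemma ofLp_matVec {p q : ℕ} (A : Matrix (Fin p) (Fin q) ℝ) (x : Vec q) :
    (A ⬝ₑ x).ofLp = A *ᵥ x.ofLp := rfl

lemma mul_matVec {p q r : ℕ} (A : Matrix (Fin p) (Fin q) ℝ) (B : Matrix (Fin q) (Fin r) ℝ)
    (x : Vec r) : (A * B) ⬝ₑ x = A ⬝ₑ B ⬝ₑ x := by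
  ext1
  simp only [ofLp_matVec, Matrix.mulVec_mulVec]

lemma add_matVec {p q : ℕ} (A B : Matrix (Fin p) (Fin q) ℝ) (x : Vec q) :
    (A + B) ⬝ₑ x = A ⬝ₑ x + B ⬝ₑ x := by
  rw [matVec, map_add, LinearMap.add_apply]

lemma matVec_add {p q : ℕ} (A : Matrix (Fin p) (Fin q) ℝ) (x y : Vec q) :
    A ⬝ₑ (x + y) = A ⬝ₑ x + A ⬝ₑ y :=
  map_add _ _ _

lemma matVec_sub {p q : ℕ} (A : Matrix (Fin p) (Fin q) ℝ) (x y : Vec q) :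
    A ⬝ₑ (x - y) = A ⬝ₑ x - A ⬝ₑ y :=
  map_sub _ _ _

lemma continuous_matVec {p q : ℕ} (A : Matrix (Fin p) (Fin q) ℝ) :
    Continuous fun x : Vec q => A ⬝ₑ x :=
  LinearMap.continuous_of_finiteDimensional _

lemma measurable_matVec {p q : ℕ} (A : Matrix (Fin p) (Fin q) ℝ) :
    Measurable fun x : Vec q => A ⬝ₑ x :=
  (continuous_matVec A).measurable

lemma inner_eq_dotProduct {d : ℕ} (x y : Vec d) : inner ℝ x y = x.ofLp ⬝ᵥ y.ofLp := by
  simp [PiLp.inner_apply, dotProduct, mul_comm]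

lemma inner_matVec_left {p q : ℕ} (A : Matrix (Fin p) (Fin q) ℝ) (x : Vec q) (y : Vec p) :
    inner ℝ (A ⬝ₑ x) y = inner ℝ x (Aᵀ ⬝ₑ y) := by
  rw [inner_eq_dotProduct, inner_eq_dotProduct, ofLp_matVec, ofLp_matVec,
    Matrix.dotProduct_mulVec, Matrix.vecMul_transpose]

/-! ### Positive semidefinite matrices -/

lemma Matrix.PosSemidef.mul_mul_transpose {p q : ℕ} {S : Matrix (Fin q) (Fin q) ℝ}
    (hS : S.PosSemidef) (A : Matrix (Fin p) (Fin q) ℝ) : (A * S * Aᵀ).PosSemidef := by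
  simpa only [Matrix.conjTranspose_eq_transpose_of_trivial] using hS.mul_mul_conjTranspose_same A

lemma Matrix.PosSemidef.transpose_eq {d : ℕ} {S : Matrix (Fin d) (Fin d) ℝ}
    (hS : S.PosSemidef) : Sᵀ = S := by
  simpa only [Matrix.conjTranspose_eq_transpose_of_trivial] using hS.isHermitian.eq

lemma Matrix.PosSemidef.mul_mul_transpose_add_posDef {p q : ℕ} {S : Matrix (Fin q) (Fin q) ℝ}
    (hS : S.PosSemidef) (A : Matrix (Fin p) (Fin q) ℝ) {R : Matrix (Fin p) (Fin p) ℝ}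
    (hR : R.PosDef) : (A * S * Aᵀ + R).PosDef :=
  add_comm R _ ▸ hR.add_posSemidef (hS.mul_mul_transpose A)

/-! ### Symmetric square roots -/

section Sqrt

open scoped MatrixOrder

variable {d : ℕ} {S : Matrix (Fin d) (Fin d) ℝ}

lemma Matrix.sqrt_transpose (S : Matrix (Fin d) (Fin d) ℝ) : (CFC.sqrt S)ᵀ = CFC.sqrt S :=
  (Matrix.nonneg_iff_posSemidef.1 (CFC.sqrt_nonneg S)).transpose_eq

lemma Matrix.PosSemidef.sqrt_mul_sqrt (hS : S.PosSemidef) : CFC.sqrt S * CFC.sqrt S = S :=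
  CFC.sqrt_mul_sqrt_self _ hS.nonneg

end Sqrt

/-! ### Affine images, convolutions and mixtures of Gaussian laws -/

lemma map_matVec_add_multivariateGaussian {p q : ℕ} (A : Matrix (Fin p) (Fin q) ℝ) (c : Vec p)
    (μ : Vec q) {S : Matrix (Fin q) (Fin q) ℝ} (hS : S.PosSemidef) :
    (multivariateGaussian μ S).map (fun x => A ⬝ₑ x + c) =
      multivariateGaussian (A ⬝ₑ μ + c) (A * S * Aᵀ) := by
  have hm : Measurable fun x : Vec q => A ⬝ₑ x + c := (measurable_matVec A).add_const c
  have : IsProbabilityMeasure ((multivariateGaussian μ S).map (fun x => A ⬝ₑ x + c)) :=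
    Measure.isProbabilityMeasure_map hm.aemeasurable
  apply Measure.ext_of_charFun
  ext t
  have key : ∀ x : Vec q, Complex.exp (↑(inner ℝ (A ⬝ₑ x + c) t) * Complex.I) =
      Complex.exp (↑(inner ℝ x (Aᵀ ⬝ₑ t)) * Complex.I) *
        Complex.exp (↑(inner ℝ c t) * Complex.I) := by
    intro x
    rw [← Complex.exp_add, inner_add_left, inner_matVec_left]
    push_cast
    ring_nf
  rw [charFun_apply, integral_map hm.aemeasurable (by fun_prop)]
  simp_rw [key]
  rw [integral_mul_const, ← charFun_apply, charFun_multivariateGaussian hS,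
    charFun_multivariateGaussian (hS.mul_mul_transpose A), ← Complex.exp_add]
  congr 1
  have h1 : (Aᵀ ⬝ₑ t).ofLp ⬝ᵥ S *ᵥ (Aᵀ ⬝ₑ t).ofLp = t.ofLp ⬝ᵥ (A * S * Aᵀ) *ᵥ t.ofLp := by
    rw [ofLp_matVec, ← Matrix.mulVec_mulVec, ← Matrix.mulVec_mulVec,
      Matrix.dotProduct_mulVec t.ofLp A, Matrix.mulVec_transpose]
  have h2 : inner ℝ (Aᵀ ⬝ₑ t) μ = inner ℝ t (A ⬝ₑ μ) := by
    rw [inner_matVec_left, Matrix.transpose_transpose]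
  rw [h1, h2, inner_add_right, real_inner_comm t c]
  push_cast
  ring

open scoped MatrixOrder in
-- This reduces statements about a possibly singular covariance to the standard Gaussian, which has
-- a density.
lemma multivariateGaussian_eq_map_stdGaussian {d : ℕ} (μ : Vec d) (S : Matrix (Fin d) (Fin d) ℝ) :
    multivariateGaussian μ S =
      (multivariateGaussian 0 (1 : Matrix (Fin d) (Fin d) ℝ)).map (fun x => CFC.sqrt S ⬝ₑ x + μ) := by
  simp_rw [multivariateGaussian_zero_one, add_comm _ μ]
  rfl

lemma multivariateGaussian_eq_map_add {d : ℕ} (μ : Vec d) (S : Matrix (Fin d) (Fin d) ℝ) :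
    multivariateGaussian μ S = (multivariateGaussian 0 S).map (fun x => μ + x) := by
  rw [multivariateGaussian_eq_map_stdGaussian 0, Measure.map_map (by fun_prop)
    ((measurable_matVec _).add_const _), multivariateGaussian_eq_map_stdGaussian μ]
  congr 1
  ext1 x
  simp [add_comm]

lemma multivariateGaussian_conv {d : ℕ} (μ ν : Vec d) {S Q : Matrix (Fin d) (Fin d) ℝ}
    (hS : S.PosSemidef) (hQ : Q.PosSemidef) :
    multivariateGaussian μ S ∗ multivariateGaussian ν Q = multivariateGaussian (μ + ν) (S + Q) := by
  apply Measure.ext_of_charFun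
  ext t
  rw [charFun_conv, charFun_multivariateGaussian hS, charFun_multivariateGaussian hQ,
    charFun_multivariateGaussian (hS.add hQ), ← Complex.exp_add, inner_add_right,
    Matrix.add_mulVec, dotProduct_add]
  push_cast
  ring_nf

lemma measurable_map_add_left {d : ℕ} (ν : Measure (Vec d)) [SFinite ν] :
    Measurable fun x : Vec d => ν.map (fun w => x + w) := by
  have h : (fun x : Vec d => ν.map (fun w => x + w)) =
      fun x => (ν.map (Prod.mk x)).map (fun z : Vec d × Vec d => z.1 + z.2) := by
    ext1 x
    rw [Measure.map_map (by fun_prop) (by fun_prop)]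
    rfl
  rw [h]
  exact (Measure.measurable_map _ (by fun_prop)).comp Measurable.map_prodMk_left

/-- For independent `X ∼ μ` and `W ∼ ν`, both sides are the law of `f X + W`; the proof is Tonelli
on the product measure. -/
lemma bind_map_add_left {α : Type*} [MeasurableSpace α] {d : ℕ} (μ : Measure α) [SFinite μ]
    (ν : Measure (Vec d)) [SFinite ν] {f : α → Vec d} (hf : Measurable f) :
    μ.bind (fun x => ν.map (fun w => f x + w)) = μ.map f ∗ ν := by
  ext s hs
  have hm : Measurable fun x => ν.map (fun w => f x + w) := (measurable_map_add_left ν).comp hf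
  rw [Measure.bind_apply hs hm.aemeasurable, Measure.conv,
    Measure.map_apply (by fun_prop) hs, Measure.prod_apply (hs.preimage (by fun_prop)),
    lintegral_map (measurable_measure_prodMk_left (hs.preimage (by fun_prop))) hf]
  refine lintegral_congr fun x => ?_
  rw [Measure.map_apply (by fun_prop) hs]
  rfl

/-- A Gaussian mixture of Gaussian laws whose mean is affine in the mixing variable. -/
lemma bind_multivariateGaussian {p q : ℕ} (A : Matrix (Fin p) (Fin q) ℝ) (c : Vec p)
    (μ : Vec q) {S : Matrix (Fin q) (Fin q) ℝ} {Q : Matrix (Fin p) (Fin p) ℝ}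
    (hS : S.PosSemidef) (hQ : Q.PosSemidef) :
    (multivariateGaussian μ S).bind (fun x => multivariateGaussian (A ⬝ₑ x + c) Q) =
      multivariateGaussian (A ⬝ₑ μ + c) (A * S * Aᵀ + Q) := by
  simp_rw [fun x => multivariateGaussian_eq_map_add (A ⬝ₑ x + c) Q]
  rw [bind_map_add_left _ _ ((measurable_matVec A).add_const c),
    map_matVec_add_multivariateGaussian A c μ hS,
    multivariateGaussian_conv _ _ (hS.mul_mul_transpose A) hQ, add_zero]

/-! ### Moments of Gaussian laws -/

lemma meanVec_multivariateGaussian {d : ℕ} (μ : Vec d) (S : Matrix (Fin d) (Fin d) ℝ) :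
    meanVec (multivariateGaussian μ S) = μ :=
  integral_id_multivariateGaussian

lemma covMat_multivariateGaussian {d : ℕ} (μ : Vec d) {S : Matrix (Fin d) (Fin d) ℝ}
    (hS : S.PosSemidef) : covMat (multivariateGaussian μ S) = S := by
  ext i j
  exact covariance_eval_multivariateGaussian hS i j

/-! ### Gaussian densities -/

/-- Only the innovation `x - μ` enters the density; this justifies the shift from the measured
output to the output of the induced system. -/
lemma gaussianDensity_of_sub_eq {d : ℕ} {μ ν x y : Vec d} (S : Matrix (Fin d) (Fin d) ℝ)
    (h : x - μ = y - ν) : gaussianDensity μ S x = gaussianDensity ν S y := by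
  rw [gaussianDensity, gaussianDensity, h]

lemma continuous_gaussianDensity {d : ℕ} (S : Matrix (Fin d) (Fin d) ℝ) :
    Continuous fun p : Vec d × Vec d => gaussianDensity p.1 S p.2 := by
  unfold gaussianDensity
  refine ENNReal.continuous_ofReal.comp (continuous_const.mul (Real.continuous_exp.comp
    (continuous_const.mul ?_)))
  have h : Continuous fun p : Vec d × Vec d => (p.2 - p.1 : Vec d).ofLp :=
    (PiLp.continuous_ofLp 2 _).comp (continuous_snd.sub continuous_fst)
  exact h.dotProduct (continuous_const.matrix_mulVec h)

lemma gaussianDensity_ne_top {d : ℕ} (μ : Vec d) (S : Matrix (Fin d) (Fin d) ℝ) (x : Vec d) :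
    gaussianDensity μ S x ≠ ∞ :=
  ENNReal.ofReal_ne_top

lemma gaussianDensity_ne_zero {d : ℕ} (μ : Vec d) {S : Matrix (Fin d) (Fin d) ℝ} (hS : S.PosDef)
    (x : Vec d) : gaussianDensity μ S x ≠ 0 := by
  have := hS.det_pos
  rw [gaussianDensity, Ne, ENNReal.ofReal_eq_zero, not_le]
  positivity

lemma MeasureTheory.Measure.withDensity_map_eq {α β : Type*} [MeasurableSpace α]
    [MeasurableSpace β] (μ : Measure α) {f : α → β} (hf : Measurable f) {g : β → ℝ≥0∞}
    (hg : Measurable g) : (μ.map f).withDensity g = (μ.withDensity fun x => g (f x)).map f := by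
  ext s hs
  rw [withDensity_apply _ hs, setLIntegral_map hs hg hf, Measure.map_apply hf hs,
    withDensity_apply _ (hf hs)]

lemma gaussianDensity_zero_one {d : ℕ} (x : Vec d) :
    gaussianDensity 0 (1 : Matrix (Fin d) (Fin d) ℝ) x =
      ENNReal.ofReal ((√((2 * Real.pi) ^ d))⁻¹ * Real.exp (-(1 / 2) * ‖x‖ ^ 2)) := by
  rw [gaussianDensity, EuclideanSpace.real_norm_sq_eq]
  simp [dotProduct, sq]

/-- Both characteristic functions equal `exp (-‖t‖² / 2)`, by the Fourier transform of `exp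
(-b‖x‖²)` at `b = 1/2`. -/
lemma multivariateGaussian_zero_one_eq_withDensity (d : ℕ) :
    multivariateGaussian 0 (1 : Matrix (Fin d) (Fin d) ℝ) =
      (volume : Measure (Vec d)).withDensity (gaussianDensity 0 1) := by
  have hre : (0 : ℝ) < (1 / 2 : ℂ).re := by norm_num
  have hint : Integrable fun x : Vec d =>
      (√((2 * Real.pi) ^ d))⁻¹ * Real.exp (-(1 / 2) * ‖x‖ ^ 2) := by
    refine Integrable.const_mul ?_ _
    have := (GaussianFourier.integrable_cexp_neg_mul_sq_norm_add hre 0 (0 : Vec d)).re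
    refine this.congr (ae_of_all _ fun x => ?_)
    have : (-(1 / 2 : ℂ) * (‖x‖ : ℂ) ^ 2 + 0 * ((inner ℝ (0 : Vec d) x : ℝ) : ℂ)) =
      ((-(1 / 2) * ‖x‖ ^ 2 : ℝ) : ℂ) := by push_cast; ring
    simp only [this]
    exact Complex.exp_ofReal_re _
  have hg : (gaussianDensity 0 1 : Vec d → ℝ≥0∞) = fun x =>
      ENNReal.ofReal ((√((2 * Real.pi) ^ d))⁻¹ * Real.exp (-(1 / 2) * ‖x‖ ^ 2)) :=
    funext gaussianDensity_zero_one
  rw [hg]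
  have := isFiniteMeasure_withDensity_ofReal hint.2
  apply Measure.ext_of_charFun
  ext t
  rw [multivariateGaussian_zero_one, charFun_stdGaussian, charFun_apply,
    integral_withDensity_eq_integral_toReal_smul (by fun_prop)
      (ae_of_all _ fun _ => ENNReal.ofReal_lt_top)]
  have key : ∀ x : Vec d,
      (ENNReal.ofReal ((√((2 * Real.pi) ^ d))⁻¹ * Real.exp (-(1 / 2) * ‖x‖ ^ 2))).toReal •
        Complex.exp (↑(inner ℝ x t) * Complex.I) =
      ((√((2 * Real.pi) ^ d))⁻¹ : ℝ) *
        Complex.exp (-(1 / 2) * (‖x‖ : ℂ) ^ 2 + Complex.I * ((inner ℝ t x : ℝ) : ℂ)) := by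
    intro x
    rw [ENNReal.toReal_ofReal (by positivity), Complex.real_smul, real_inner_comm t x,
      Complex.exp_add]
    push_cast
    ring_nf
  simp_rw [key]
  rw [integral_const_mul, GaussianFourier.integral_cexp_neg_mul_sq_norm_add hre, ← mul_assoc]
  -- The Fourier formula carries the factor `(π/b)^(d/2)`, which is `√((2π)^d)` at `b = 1/2`.
  have hc : (((√((2 * Real.pi) ^ d))⁻¹ : ℝ) : ℂ) *
      ((Real.pi : ℂ) / (1 / 2)) ^ ((Module.finrank ℝ (Vec d) : ℂ) / 2) = 1 := by
    have h1 : ((Real.pi : ℂ) / (1 / 2)) ^ ((Module.finrank ℝ (Vec d) : ℂ) / 2) =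
        ((√((2 * Real.pi) ^ d) : ℝ) : ℂ) := by
      rw [Real.sqrt_eq_rpow, ← Real.rpow_natCast, ← Real.rpow_mul (by positivity),
        Complex.ofReal_cpow (by positivity), finrank_euclideanSpace_fin]
      push_cast
      congr 1 <;> ring
    rw [h1, ← Complex.ofReal_mul, inv_mul_cancel₀ (by positivity), Complex.ofReal_one]
  rw [hc, one_mul, Complex.I_sq]
  congr 1
  ring

section

open scoped MatrixOrder

lemma Matrix.PosDef.det_sqrt_pos {d : ℕ} {S : Matrix (Fin d) (Fin d) ℝ} (hS : S.PosDef) :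
    0 < (CFC.sqrt S).det := by
  have h0 : 0 ≤ (CFC.sqrt S).det :=
    (Matrix.nonneg_iff_posSemidef.1 (CFC.sqrt_nonneg S)).det_nonneg
  refine lt_of_le_of_ne h0 fun h => hS.det_pos.ne' ?_
  rw [← hS.posSemidef.sqrt_mul_sqrt, Matrix.det_mul, ← h, mul_zero]

/-- Change of variables by `√S`: the quadratic form becomes `‖w‖²`, and `det √S`, the root of `det
S`, is the Jacobian. -/
lemma gaussianDensity_sqrt_matVec {d : ℕ} (μ : Vec d) {S : Matrix (Fin d) (Fin d) ℝ}
    (hS : S.PosDef) (w : Vec d) :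
    gaussianDensity 0 1 w =
      ENNReal.ofReal (CFC.sqrt S).det * gaussianDensity μ S (CFC.sqrt S ⬝ₑ w + μ) := by
  have hpos := hS.det_sqrt_pos
  have hSS := hS.posSemidef.sqrt_mul_sqrt
  have hT := Matrix.sqrt_transpose S
  set V := CFC.sqrt S
  have hV : IsUnit V.det := hpos.ne'.isUnit
  have hdet : S.det = V.det * V.det := by rw [← Matrix.det_mul, hSS]
  have hquad : (V *ᵥ w.ofLp) ⬝ᵥ S⁻¹ *ᵥ (V *ᵥ w.ofLp) = w.ofLp ⬝ᵥ w.ofLp := by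
    have h1 : S⁻¹ = V⁻¹ * V⁻¹ := by rw [← hSS, Matrix.mul_inv_rev]
    have h2 : Vᵀ * (V⁻¹ * V⁻¹ * V) = 1 := by
      rw [hT, Matrix.mul_assoc V⁻¹, Matrix.nonsing_inv_mul _ hV, Matrix.mul_one,
        Matrix.mul_nonsing_inv _ hV]
    rw [Matrix.mulVec_mulVec, h1, ← Matrix.vecMul_transpose, ← Matrix.dotProduct_mulVec,
      Matrix.mulVec_mulVec, h2, Matrix.one_mulVec]
  rw [gaussianDensity, gaussianDensity, ← ENNReal.ofReal_mul hpos.le, add_sub_cancel_right,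
    ofLp_matVec, hquad, sub_zero, inv_one, Matrix.one_mulVec, Matrix.det_one, mul_one, hdet,
    Real.sqrt_mul (by positivity), Real.sqrt_mul_self hpos.le, ← mul_assoc]
  congr 2
  field_simp

/-- A nondegenerate Gaussian law has the Gaussian density. -/
theorem multivariateGaussian_eq_withDensity {d : ℕ} (μ : Vec d) {S : Matrix (Fin d) (Fin d) ℝ}
    (hS : S.PosDef) :
    multivariateGaussian μ S = (volume : Measure (Vec d)).withDensity (gaussianDensity μ S) := by
  have hpos := hS.det_sqrt_pos
  have hg : Measurable (gaussianDensity μ S) :=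
    ((continuous_gaussianDensity S).comp (Continuous.prodMk_right μ)).measurable
  have hf : Measurable fun x : Vec d => CFC.sqrt S ⬝ₑ x + μ := (measurable_matVec _).add_const _
  -- The inverse Jacobian produced here cancels the factor `det √S` of `h0`.
  have hvol : (volume : Measure (Vec d)).map (fun x => CFC.sqrt S ⬝ₑ x + μ) =
      ENNReal.ofReal (CFC.sqrt S).det⁻¹ • volume := by
    have h1 : (fun x : Vec d => CFC.sqrt S ⬝ₑ x + μ) =
      (fun x => x + μ) ∘ (Matrix.toEuclideanLin (CFC.sqrt S)) := rfl
    have hdet : LinearMap.det (Matrix.toEuclideanLin (CFC.sqrt S)) = (CFC.sqrt S).det :=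
      LinearMap.det_toLpLin _ _
    rw [h1, ← Measure.map_map (by fun_prop) (measurable_matVec _),
      Measure.map_linearMap_addHaar_eq_smul_addHaar _ (hdet ▸ hpos.ne'), hdet,
      abs_of_pos (inv_pos.2 hpos), Measure.map_smul, map_add_right_eq_self]
  have h0 : (gaussianDensity 0 1 : Vec d → ℝ≥0∞) = fun w =>
      (ENNReal.ofReal (CFC.sqrt S).det • gaussianDensity μ S) (CFC.sqrt S ⬝ₑ w + μ) :=
    funext fun w => gaussianDensity_sqrt_matVec μ hS w
  rw [multivariateGaussian_eq_map_stdGaussian, multivariateGaussian_zero_one_eq_withDensity, h0,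
    ← Measure.withDensity_map_eq _ hf (hg.const_smul _), hvol, withDensity_smul_measure,
    withDensity_smul _ hg, smul_smul, ← ENNReal.ofReal_mul (inv_pos.2 hpos).le,
    inv_mul_cancel₀ hpos.ne', ENNReal.ofReal_one, one_smul]

end

/-! ### Conditioning -/

section Conditioning

variable {d l : ℕ} (G : Matrix (Fin l) (Fin d) ℝ) {R : Matrix (Fin l) (Fin l) ℝ}

lemma mul_transpose_add_posDef (hR : R.PosDef) : (G * Gᵀ + R).PosDef := by
  simpa using Matrix.PosSemidef.one.mul_mul_transpose_add_posDef G hR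

/-- Push-through identity: `(1 + Gᵀ R⁻¹ G) Gᵀ = Gᵀ R⁻¹ (G Gᵀ + R)`, multiplied on the right by the
inverse of the last factor. -/
lemma one_add_mul_gain (hR : R.PosDef) :
    (1 + Gᵀ * R⁻¹ * G) * (Gᵀ * (G * Gᵀ + R)⁻¹) = Gᵀ * R⁻¹ := by
  have hW : IsUnit (G * Gᵀ + R).det := (mul_transpose_add_posDef G hR).det_pos.ne'.isUnit
  have hR' : IsUnit R.det := hR.det_pos.ne'.isUnit
  have h : (1 + Gᵀ * R⁻¹ * G) * Gᵀ = Gᵀ * R⁻¹ * (G * Gᵀ + R) := by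
    rw [Matrix.add_mul, Matrix.mul_add, Matrix.one_mul, Matrix.mul_assoc Gᵀ R⁻¹ R,
      Matrix.nonsing_inv_mul _ hR', Matrix.mul_one, Matrix.mul_assoc _ G, add_comm]
  rw [← Matrix.mul_assoc, h, Matrix.mul_assoc, Matrix.mul_nonsing_inv _ hW, Matrix.mul_one]

lemma inv_eq_inv_add_gain (hR : R.PosDef) :
    R⁻¹ = (G * Gᵀ + R)⁻¹ + (G * Gᵀ + R)⁻¹ * G * (Gᵀ * R⁻¹) := by
  have hW : IsUnit (G * Gᵀ + R).det := (mul_transpose_add_posDef G hR).det_pos.ne'.isUnit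
  have hR' : IsUnit R.det := hR.det_pos.ne'.isUnit
  have h : (G * Gᵀ + R) * R⁻¹ = 1 + G * (Gᵀ * R⁻¹) := by
    rw [Matrix.add_mul, Matrix.mul_nonsing_inv _ hR', Matrix.mul_assoc, add_comm]
  calc R⁻¹ = (G * Gᵀ + R)⁻¹ * ((G * Gᵀ + R) * R⁻¹) := by
        rw [← Matrix.mul_assoc, Matrix.nonsing_inv_mul _ hW, Matrix.one_mul]
    _ = _ := by rw [h, Matrix.mul_add, Matrix.mul_one, Matrix.mul_assoc _ G]

/-- Woodbury's identity: for a standard prior, the posterior precision `1 + Gᵀ R⁻¹ G` inverts the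
covariance in gain form. -/
lemma one_add_mul_one_sub_gain (hR : R.PosDef) :
    (1 + Gᵀ * R⁻¹ * G) * (1 - Gᵀ * (G * Gᵀ + R)⁻¹ * G) = 1 := by
  rw [Matrix.mul_sub, ← Matrix.mul_assoc, one_add_mul_gain G hR, Matrix.mul_one,
    add_sub_cancel_right]

lemma one_add_posDef (hR : R.PosDef) : (1 + Gᵀ * R⁻¹ * G).PosDef :=
  Matrix.PosDef.one.add_posSemidef (by
    simpa using hR.inv.posSemidef.mul_mul_transpose Gᵀ)

lemma inv_one_sub_gain (hR : R.PosDef) :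
    (1 - Gᵀ * (G * Gᵀ + R)⁻¹ * G)⁻¹ = 1 + Gᵀ * R⁻¹ * G :=
  Matrix.inv_eq_left_inv (one_add_mul_one_sub_gain G hR)

lemma one_sub_gain_posDef (hR : R.PosDef) : (1 - Gᵀ * (G * Gᵀ + R)⁻¹ * G).PosDef := by
  rw [← Matrix.inv_eq_right_inv (one_add_mul_one_sub_gain G hR)]
  exact (one_add_posDef G hR).inv

/-- Sylvester's identity `det (1 + XY) = det (1 + YX)` links `G Gᵀ + R` to the posterior precision.
It matches the normalizing constants in Bayes' rule. -/
lemma det_mul_det_one_sub_gain (hR : R.PosDef) :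
    (G * Gᵀ + R).det * (1 - Gᵀ * (G * Gᵀ + R)⁻¹ * G).det = R.det := by
  have hR' : IsUnit R.det := hR.det_pos.ne'.isUnit
  have h1 : G * Gᵀ + R = (1 + G * (Gᵀ * R⁻¹)) * R := by
    rw [Matrix.add_mul, Matrix.one_mul, ← Matrix.mul_assoc G, Matrix.mul_assoc (G * Gᵀ),
      Matrix.nonsing_inv_mul _ hR', Matrix.mul_one, add_comm]
  have h2 := congrArg Matrix.det (one_add_mul_one_sub_gain G hR)
  rw [Matrix.det_mul, Matrix.det_one] at h2
  conv_lhs => enter [1]; rw [h1, Matrix.det_mul, Matrix.det_one_add_mul_comm]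
  rw [mul_right_comm, h2, one_mul]

/-- Completion of the square. -/
lemma gain_quadratic_form (hR : R.PosDef) (y : Fin l → ℝ) (w : Fin d → ℝ) :
    w ⬝ᵥ w + (y - G *ᵥ w) ⬝ᵥ R⁻¹ *ᵥ (y - G *ᵥ w) =
      y ⬝ᵥ (G * Gᵀ + R)⁻¹ *ᵥ y +
      (w - (Gᵀ * (G * Gᵀ + R)⁻¹) *ᵥ y) ⬝ᵥ (1 + Gᵀ * R⁻¹ * G) *ᵥ
        (w - (Gᵀ * (G * Gᵀ + R)⁻¹) *ᵥ y) := by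
  have hWT : ((G * Gᵀ + R)⁻¹)ᵀ = (G * Gᵀ + R)⁻¹ :=
    (mul_transpose_add_posDef G hR).inv.posSemidef.transpose_eq
  have hRT : (R⁻¹)ᵀ = R⁻¹ := hR.inv.posSemidef.transpose_eq
  have hVT : (1 + Gᵀ * R⁻¹ * G)ᵀ = 1 + Gᵀ * R⁻¹ * G :=
    (one_add_posDef G hR).posSemidef.transpose_eq
  have hVL := one_add_mul_gain G hR
  have hinv := inv_eq_inv_add_gain G hR
  set W := (G * Gᵀ + R)⁻¹
  set V := 1 + Gᵀ * R⁻¹ * G with hV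
  have hLT : (Gᵀ * W)ᵀ = W * G := by
    rw [Matrix.transpose_mul, Matrix.transpose_transpose, hWT]
  have e1 : (y - G *ᵥ w) ⬝ᵥ R⁻¹ *ᵥ (y - G *ᵥ w) = y ⬝ᵥ R⁻¹ *ᵥ y - 2 * (w ⬝ᵥ (Gᵀ * R⁻¹) *ᵥ y) +
      w ⬝ᵥ (Gᵀ * R⁻¹ * G) *ᵥ w := by
    have a1 : y ⬝ᵥ R⁻¹ *ᵥ G *ᵥ w = w ⬝ᵥ (Gᵀ * R⁻¹) *ᵥ y := by
      rw [Matrix.mulVec_mulVec, Matrix.dotProduct_mulVec, dotProduct_comm,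
        ← Matrix.mulVec_transpose, Matrix.transpose_mul, hRT]
    have a2 : ∀ v, G *ᵥ w ⬝ᵥ v = w ⬝ᵥ Gᵀ *ᵥ v := fun v => by
      rw [Matrix.dotProduct_mulVec, Matrix.vecMul_transpose]
    rw [Matrix.mulVec_sub, dotProduct_sub, sub_dotProduct, sub_dotProduct, a1, a2, a2,
      Matrix.mulVec_mulVec, Matrix.mulVec_mulVec, Matrix.mulVec_mulVec]
    ring
  have e2 : (w - (Gᵀ * W) *ᵥ y) ⬝ᵥ V *ᵥ (w - (Gᵀ * W) *ᵥ y) =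
      w ⬝ᵥ V *ᵥ w - 2 * (w ⬝ᵥ (Gᵀ * R⁻¹) *ᵥ y) + y ⬝ᵥ (W * G * (Gᵀ * R⁻¹)) *ᵥ y := by
    have a1 : V *ᵥ (Gᵀ * W) *ᵥ y = (Gᵀ * R⁻¹) *ᵥ y := by rw [Matrix.mulVec_mulVec, hVL]
    have a2 : (Gᵀ * W) *ᵥ y ⬝ᵥ V *ᵥ w = w ⬝ᵥ (Gᵀ * R⁻¹) *ᵥ y := by
      rw [Matrix.dotProduct_mulVec, dotProduct_comm, ← Matrix.mulVec_transpose, hVT, a1]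
    have a3 : (Gᵀ * W) *ᵥ y ⬝ᵥ (Gᵀ * R⁻¹) *ᵥ y = y ⬝ᵥ (W * G * (Gᵀ * R⁻¹)) *ᵥ y := by
      rw [← Matrix.mulVec_mulVec y (W * G), Matrix.dotProduct_mulVec y (W * G), ← hLT,
        Matrix.vecMul_transpose]
    rw [Matrix.mulVec_sub, dotProduct_sub, sub_dotProduct, sub_dotProduct, a1, a2, a3]
    ring
  rw [e1, e2, hV, Matrix.add_mulVec, dotProduct_add, Matrix.one_mulVec]
  -- Only the pure `y` term is split: one summand is the evidence term, the other is the `y` term of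
  -- `e2`.
  conv_lhs => enter [2, 1, 1]; rw [hinv, Matrix.add_mulVec, dotProduct_add]
  ring

/-- Bayes' rule for a standard prior: the exponents agree by `gain_quadratic_form` and the constants
by `det_mul_det_one_sub_gain`. -/
lemma gaussianDensity_mul_gaussianDensity (hR : R.PosDef) (c y : Vec l) (w : Vec d) :
    gaussianDensity 0 1 w * gaussianDensity (G ⬝ₑ w + c) R y =
      gaussianDensity c (G * Gᵀ + R) y *
        gaussianDensity ((Gᵀ * (G * Gᵀ + R)⁻¹) ⬝ₑ (y - c)) (1 - Gᵀ * (G * Gᵀ + R)⁻¹ * G) w := by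
  have hW := (mul_transpose_add_posDef G hR).det_pos
  have hV := (one_sub_gain_posDef G hR).det_pos
  have hRd := hR.det_pos
  have hquad := gain_quadratic_form G hR (y - c).ofLp w.ofLp
  have hsub : (y - (G ⬝ₑ w + c)).ofLp = (y - c).ofLp - G *ᵥ w.ofLp := by
    rw [add_comm, ← sub_sub, WithLp.ofLp_sub, ofLp_matVec]
  simp only [gaussianDensity]
  rw [← ENNReal.ofReal_mul (by positivity), ← ENNReal.ofReal_mul (by positivity),
    mul_mul_mul_comm, mul_mul_mul_comm (√((2 * Real.pi) ^ l * (G * Gᵀ + R).det))⁻¹,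
    ← Real.exp_add, ← Real.exp_add, ← mul_add, ← mul_add, inv_one_sub_gain G hR, hsub,
    WithLp.ofLp_sub 2 w (_ ⬝ₑ _), ofLp_matVec, sub_zero, inv_one, Matrix.one_mulVec, hquad, ← mul_inv,
    ← mul_inv, Matrix.det_one, mul_one, ← Real.sqrt_mul (by positivity),
    ← Real.sqrt_mul (by positivity), ← det_mul_det_one_sub_gain G hR]
  congr 4
  ring

end Conditioning

/-! ### Bayes' rule for Gaussian priors, possibly singular -/

section BayesRule

open scoped MatrixOrder

variable {d l : ℕ} (H : Matrix (Fin l) (Fin d) ℝ) (μ : Vec d) {P : Matrix (Fin d) (Fin d) ℝ}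
  {R : Matrix (Fin l) (Fin l) ℝ}

/-- Pushing the posterior of the whitened variable `w` forward by `√P` brings its covariance to the
Kalman form; no inverse of `P` occurs. -/
lemma sqrt_mul_one_sub_mul_sqrt (hP : P.PosSemidef) (W : Matrix (Fin l) (Fin l) ℝ) :
    CFC.sqrt P * (1 - (H * CFC.sqrt P)ᵀ * W * (H * CFC.sqrt P)) * (CFC.sqrt P)ᵀ =
      P - P * Hᵀ * W * H * P := by
  conv_rhs => rw [← hP.sqrt_mul_sqrt]
  simp only [Matrix.mul_sub, Matrix.sub_mul, Matrix.transpose_mul, Matrix.sqrt_transpose,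
    Matrix.mul_one, Matrix.mul_assoc]

lemma measurable_gaussianDensity_matVec (c y : Vec l) (R : Matrix (Fin l) (Fin l) ℝ) :
    Measurable fun x : Vec d => gaussianDensity (H ⬝ₑ x + c) R y :=
  ((continuous_gaussianDensity R).comp
    (((continuous_matVec H).add continuous_const).prodMk continuous_const)).measurable

/-- Reweighting a Gaussian prior by the likelihood of a linear observation with Gaussian noise:
the evidence times the Gaussian posterior. -/
lemma multivariateGaussian_withDensity_gaussianDensity (hP : P.PosSemidef) (hR : R.PosDef)
    (c y : Vec l) :
    (multivariateGaussian μ P).withDensity (fun x => gaussianDensity (H ⬝ₑ x + c) R y) =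
      gaussianDensity (H ⬝ₑ μ + c) (H * P * Hᵀ + R) y •
        multivariateGaussian (μ + (P * Hᵀ * (H * P * Hᵀ + R)⁻¹) ⬝ₑ (y - (H ⬝ₑ μ + c)))
          (P - P * Hᵀ * (H * P * Hᵀ + R)⁻¹ * H * P) := by
  have hSS := hP.sqrt_mul_sqrt
  have hST := Matrix.sqrt_transpose P
  have hstd := multivariateGaussian_eq_map_stdGaussian μ P
  set S := CFC.sqrt P
  have hf : Measurable fun x : Vec d => S ⬝ₑ x + μ := (measurable_matVec S).add_const μ
  have hG : (H * S) * (H * S)ᵀ = H * P * Hᵀ := by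
    rw [Matrix.transpose_mul, hST, ← Matrix.mul_assoc, Matrix.mul_assoc H S S, hSS]
  have hSG : S * (H * S)ᵀ = P * Hᵀ := by
    rw [Matrix.transpose_mul, hST, ← Matrix.mul_assoc, hSS]
  have hV := one_sub_gain_posDef (H * S) hR
  -- In the variable `w` the observation matrix is `H * S` and the prior is standard.
  have hdens : ∀ w : Vec d, gaussianDensity 0 1 w * gaussianDensity (H ⬝ₑ (S ⬝ₑ w + μ) + c) R y =
      gaussianDensity (H ⬝ₑ μ + c) (H * P * Hᵀ + R) y *
        gaussianDensity (((H * S)ᵀ * (H * P * Hᵀ + R)⁻¹) ⬝ₑ (y - (H ⬝ₑ μ + c)))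
          (1 - (H * S)ᵀ * (H * P * Hᵀ + R)⁻¹ * (H * S)) w := by
    intro w
    rw [← hG, ← gaussianDensity_mul_gaussianDensity (H * S) hR, mul_matVec, matVec_add,
      add_assoc]
  rw [hG] at hV
  have hmeas : ∀ (ν : Vec d) (V : Matrix (Fin d) (Fin d) ℝ), Measurable (gaussianDensity ν V) :=
    fun ν V => ((continuous_gaussianDensity V).comp (Continuous.prodMk_right ν)).measurable
  have hmeas' : Measurable fun x : Vec d => gaussianDensity (H ⬝ₑ (S ⬝ₑ x + μ) + c) R y :=
    (measurable_gaussianDensity_matVec H c y R).comp hf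
  rw [hstd, Measure.withDensity_map_eq _ hf (measurable_gaussianDensity_matVec H c y R),
    multivariateGaussian_zero_one_eq_withDensity,
    ← withDensity_mul _ (hmeas _ _) hmeas']
  have hfun : ((gaussianDensity 0 1 : Vec d → ℝ≥0∞) *
      fun x : Vec d => gaussianDensity (H ⬝ₑ (S ⬝ₑ x + μ) + c) R y) =
      gaussianDensity (H ⬝ₑ μ + c) (H * P * Hᵀ + R) y •
        gaussianDensity (((H * S)ᵀ * (H * P * Hᵀ + R)⁻¹) ⬝ₑ (y - (H ⬝ₑ μ + c)))
          (1 - (H * S)ᵀ * (H * P * Hᵀ + R)⁻¹ * (H * S)) := funext hdens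
  rw [hfun, withDensity_smul _ (hmeas _ _), ← multivariateGaussian_eq_withDensity _ hV,
    Measure.map_smul, map_matVec_add_multivariateGaussian _ _ _ hV.posSemidef, ← mul_matVec,
    ← Matrix.mul_assoc, hSG, add_comm μ, sqrt_mul_one_sub_mul_sqrt H hP]

lemma posterior_posSemidef (hP : P.PosSemidef) (hR : R.PosDef) :
    (P - P * Hᵀ * (H * P * Hᵀ + R)⁻¹ * H * P).PosSemidef := by
  have h := (one_sub_gain_posDef (H * CFC.sqrt P) hR).posSemidef.mul_mul_transpose (CFC.sqrt P)
  rwa [sqrt_mul_one_sub_mul_sqrt H hP, Matrix.transpose_mul, Matrix.sqrt_transpose,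
    ← Matrix.mul_assoc, Matrix.mul_assoc H _ (CFC.sqrt P), hP.sqrt_mul_sqrt] at h

/-- The evidence of a linear observation with Gaussian noise under a Gaussian prior. -/
lemma lintegral_gaussianDensity (hP : P.PosSemidef) (hR : R.PosDef) (c y : Vec l) :
    ∫⁻ x, gaussianDensity (H ⬝ₑ x + c) R y ∂(multivariateGaussian μ P) =
      gaussianDensity (H ⬝ₑ μ + c) (H * P * Hᵀ + R) y := by
  rw [← setLIntegral_univ, ← withDensity_apply _ MeasurableSet.univ,
    multivariateGaussian_withDensity_gaussianDensity H μ hP hR, Measure.smul_apply, measure_univ,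
    smul_eq_mul, mul_one]

/-- The posterior of a Gaussian prior given a linear observation with Gaussian noise. -/
theorem bayesRule_multivariateGaussian (hP : P.PosSemidef) (hR : R.PosDef) (c y : Vec l) :
    bayesRule (multivariateGaussian μ P) (fun x => gaussianDensity (H ⬝ₑ x + c) R y) =
      multivariateGaussian (μ + (P * Hᵀ * (H * P * Hᵀ + R)⁻¹) ⬝ₑ (y - (H ⬝ₑ μ + c)))
        (P - P * Hᵀ * (H * P * Hᵀ + R)⁻¹ * H * P) := by
  -- The evidence is nonzero and finite, so normalization cancels it.
  rw [bayesRule, lintegral_gaussianDensity H μ hP hR,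
    multivariateGaussian_withDensity_gaussianDensity H μ hP hR, smul_smul,
    ENNReal.inv_mul_cancel
      (gaussianDensity_ne_zero _ (hP.mul_mul_transpose_add_posDef H hR) y)
      (gaussianDensity_ne_top _ _ _), one_smul]

end BayesRule

/-! ### The Bayes filter on the task-relevant variables -/

namespace TRVModel

variable {n m k l : ℕ} {M : TRVModel n m k l}

/-- Given the present state, the next one is affine in the TRV. The state acts directly through `A`
and through the policy by `B K C`, hence the closed-loop matrix. -/
lemma encoder_bind_dynamics {t : ℕ} (hε : (M.covEps t).PosSemidef) (hη : (M.covEta t).PosSemidef)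
    (x : Vec n) :
    (M.encoder t x).bind (fun z => M.dynamics t (M.K t ⬝ₑ z + M.h t) x) =
      multivariateGaussian
        ((M.B t * M.K t * M.C t + M.A t) ⬝ₑ x + ((M.B t * M.K t) ⬝ₑ M.a t + M.B t ⬝ₑ M.h t))
        (M.B t * M.K t * M.covEta t * (M.B t * M.K t)ᵀ + M.covEps t) := by
  have h : ∀ z, M.dynamics t (M.K t ⬝ₑ z + M.h t) x =
      multivariateGaussian ((M.B t * M.K t) ⬝ₑ z + (M.A t ⬝ₑ x + M.B t ⬝ₑ M.h t))
        (M.covEps t) := by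
    intro z
    rw [dynamics, matVec_add, mul_matVec]
    congr 1
    abel
  simp_rw [h]
  rw [encoder, bind_multivariateGaussian _ _ _ hη hε, matVec_add, add_matVec,
    mul_matVec (M.B t * M.K t) (M.C t)]
  congr 1
  abel

/-- The parameters are left existential because `stateMean` and `stateCov` are moments of the law;
they are identified once the law is known to be Gaussian. -/
lemma exists_stateLaw_eq {T : ℕ} (hx₀ : M.covX0.PosSemidef)
    (hε : ∀ t < T, (M.covEps t).PosSemidef) (hη : ∀ t < T, (M.covEta t).PosSemidef) :
    ∀ t ≤ T, ∃ μ : Vec n, ∃ P : Matrix (Fin n) (Fin n) ℝ, P.PosSemidef ∧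
      M.stateLaw t = multivariateGaussian μ P
  | 0, _ => ⟨_, _, hx₀, rfl⟩
  | t + 1, ht => by
    obtain ⟨μ, P, hP, h⟩ := exists_stateLaw_eq hx₀ hε hη t (Nat.le_of_succ_le ht)
    have hQ := ((hη t ht).mul_mul_transpose (M.B t * M.K t)).add (hε t ht)
    have hstep := bind_multivariateGaussian (M.B t * M.K t * M.C t + M.A t)
      ((M.B t * M.K t) ⬝ₑ M.a t + M.B t ⬝ₑ M.h t) μ hP hQ
    refine ⟨_, _, (hP.mul_mul_transpose (M.B t * M.K t * M.C t + M.A t)).add hQ,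
      Eq.trans ?_ hstep⟩
    rw [stateLaw, h]
    simp_rw [encoder_bind_dynamics (hε t ht) (hη t ht)]

lemma stateLaw_eq {T : ℕ} (hx₀ : M.covX0.PosSemidef)
    (hε : ∀ t < T, (M.covEps t).PosSemidef) (hη : ∀ t < T, (M.covEta t).PosSemidef)
    {t : ℕ} (ht : t ≤ T) :
    (M.stateCov t).PosSemidef ∧
      M.stateLaw t = multivariateGaussian (M.stateMean t) (M.stateCov t) := by
  obtain ⟨μ, P, hP, h⟩ := exists_stateLaw_eq hx₀ hε hη t ht
  rw [stateCov, stateMean, h, meanVec_multivariateGaussian, covMat_multivariateGaussian _ hP]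
  exact ⟨hP, rfl⟩

variable {t : ℕ}

lemma trvLaw_eq (hP : (M.stateCov t).PosSemidef)
    (hlaw : M.stateLaw t = multivariateGaussian (M.stateMean t) (M.stateCov t))
    (hη : (M.covEta t).PosDef) :
    M.trvLaw t = multivariateGaussian (M.trvMean t) (M.trvCov t) := by
  rw [trvLaw, hlaw]
  exact bind_multivariateGaussian _ _ _ hP hη.posSemidef

lemma condCov_posSemidef (hP : (M.stateCov t).PosSemidef) (hη : (M.covEta t).PosDef) :
    (M.condCov t).PosSemidef :=
  posterior_posSemidef (M.C t) hP hη

lemma stateGivenTRV_eq (hP : (M.stateCov t).PosSemidef)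
    (hlaw : M.stateLaw t = multivariateGaussian (M.stateMean t) (M.stateCov t))
    (hη : (M.covEta t).PosDef) (z : Vec k) :
    M.stateGivenTRV t z = multivariateGaussian (M.condMean t z) (M.condCov t) := by
  rw [stateGivenTRV, hlaw]
  exact bayesRule_multivariateGaussian (M.C t) _ hP hη (M.a t) z

lemma induced_R_posDef (hV : (M.condCov t).PosSemidef) (hω : (M.covOmega t).PosDef) :
    (M.induced.R t).PosDef :=
  hV.mul_mul_transpose_add_posDef _ hω

lemma induced_Q_posDef (hV : (M.condCov t).PosSemidef) (hε : (M.covEps t).PosSemidef)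
    (hη : (M.covEta (t + 1)).PosDef) : (M.induced.Q t).PosDef :=
  ((hV.mul_mul_transpose _).add hε).mul_mul_transpose_add_posDef _ hη

/-- The model is the evidence of `y` under the law of the state given the TRV; the shifted output is
chosen so that its innovation is `y - D μ_{x|z}`. -/
lemma sensorGivenTRV_eq (hV : (M.condCov t).PosSemidef)
    (hcond : ∀ z, M.stateGivenTRV t z = multivariateGaussian (M.condMean t z) (M.condCov t))
    (hω : (M.covOmega t).PosDef) (z : Vec k) (y : Vec l) :
    M.sensorGivenTRV t z y = M.induced.sensorDensity t z (M.inducedOutput t y) := by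
  have h := lintegral_gaussianDensity (M.D t) (M.condMean t z) hV hω 0 y
  simp only [add_zero] at h
  rw [sensorGivenTRV, hcond]
  refine h.trans (gaussianDensity_of_sub_eq _ ?_)
  change _ = M.inducedOutput t y - M.indD t ⬝ₑ z
  rw [condMean, inducedOutput, matVec_add, ← mul_matVec, ← Matrix.mul_assoc, ← Matrix.mul_assoc,
    ← indD, matVec_sub]
  abel

/-- Two successive mixtures, over the present and the next state; the terms constant in `z` and `u`
form the offset `r`. -/
lemma nextTRVGivenTRV_eq (hV : (M.condCov t).PosSemidef)
    (hcond : ∀ z, M.stateGivenTRV t z = multivariateGaussian (M.condMean t z) (M.condCov t))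
    (hε : (M.covEps t).PosSemidef) (hη : (M.covEta (t + 1)).PosDef) (u : Vec m) (z : Vec k) :
    M.nextTRVGivenTRV t u z = M.induced.trans t u z := by
  have h1 : M.nextStateGivenTRV t u z =
      multivariateGaussian (M.A t ⬝ₑ M.condMean t z + M.B t ⬝ₑ u)
        (M.A t * M.condCov t * (M.A t)ᵀ + M.covEps t) := by
    rw [nextStateGivenTRV, hcond]
    exact bind_multivariateGaussian (M.A t) _ _ hV hε
  have h2 := bind_multivariateGaussian (M.C (t + 1)) (M.a (t + 1))
    (M.A t ⬝ₑ M.condMean t z + M.B t ⬝ₑ u) ((hV.mul_mul_transpose (M.A t)).add hε) hη.posSemidef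
  rw [nextTRVGivenTRV, h1]
  refine h2.trans ?_
  rw [LGSystem.trans]
  congr 1
  change _ = M.indA t ⬝ₑ z + (M.C (t + 1) * M.B t) ⬝ₑ u +
    (-(M.indA t ⬝ₑ M.trvMean t) + (M.C (t + 1) * M.A t) ⬝ₑ M.stateMean t + M.a (t + 1))
  rw [condMean, matVec_add, ← mul_matVec (M.C (t + 1)) (M.A t), matVec_add, ← mul_matVec,
    ← mul_matVec, ← Matrix.mul_assoc, ← Matrix.mul_assoc, ← indA, matVec_sub]
  abel

lemma bayesPredict_eq (htrans : ∀ u z, M.nextTRVGivenTRV t u z = M.induced.trans t u z)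
    (hQ : (M.induced.Q t).PosDef) (u : Vec m) {b : Vec k × Matrix (Fin k) (Fin k) ℝ}
    (hb : b.2.PosSemidef) :
    (M.induced.kalmanPredict t u b).2.PosSemidef ∧
      M.bayesPredict t u (multivariateGaussian b.1 b.2) =
        multivariateGaussian (M.induced.kalmanPredict t u b).1
          (M.induced.kalmanPredict t u b).2 := by
  refine ⟨(hb.mul_mul_transpose _).add hQ.posSemidef, ?_⟩
  have h := bind_multivariateGaussian (M.induced.A t) (M.induced.B t ⬝ₑ u + M.induced.r t) b.1 hb
    hQ.posSemidef
  have htrans' : M.nextTRVGivenTRV t u = fun z =>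
      multivariateGaussian (M.induced.A t ⬝ₑ z + (M.induced.B t ⬝ₑ u + M.induced.r t))
        (M.induced.Q t) := by
    ext1 z
    rw [htrans, LGSystem.trans, add_assoc]
  rw [bayesPredict, htrans', h, LGSystem.kalmanPredict, add_assoc (M.induced.A t ⬝ₑ b.1)]

lemma bayesMeasurement_eq
    (hsensor : ∀ z y, M.sensorGivenTRV t z y = M.induced.sensorDensity t z (M.inducedOutput t y))
    (hR : (M.induced.R t).PosDef) (y : Vec l) {b : Vec k × Matrix (Fin k) (Fin k) ℝ}
    (hb : b.2.PosSemidef) :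
    (M.induced.kalmanMeasurement t (M.inducedOutput t y) b).2.PosSemidef ∧
      M.bayesMeasurement t y (multivariateGaussian b.1 b.2) =
        multivariateGaussian (M.induced.kalmanMeasurement t (M.inducedOutput t y) b).1
          (M.induced.kalmanMeasurement t (M.inducedOutput t y) b).2 := by
  -- Expanding `(1 - L D) P` gives the posterior covariance of Bayes' rule.
  have hcov : (M.induced.kalmanMeasurement t (M.inducedOutput t y) b).2 =
      b.2 - b.2 * (M.induced.D t)ᵀ *
        (M.induced.D t * b.2 * (M.induced.D t)ᵀ + M.induced.R t)⁻¹ * M.induced.D t * b.2 := by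
    rw [LGSystem.kalmanMeasurement, LGSystem.kalmanGain, Matrix.sub_mul, Matrix.one_mul]
  rw [hcov]
  refine ⟨posterior_posSemidef _ hb hR, ?_⟩
  have h := bayesRule_multivariateGaussian (M.induced.D t) b.1 hb hR 0 (M.inducedOutput t y)
  simp only [add_zero] at h
  simp_rw [bayesMeasurement, hsensor]
  exact h

end TRVModel


theorem theorem4 {n m k l : ℕ} (T : ℕ) (M : TRVModel n m k l)
    (hx₀ : M.covX0.PosSemidef)
    (hε : ∀ t < T, (M.covEps t).PosSemidef)
    (hη : ∀ t ≤ T, (M.covEta t).PosDef)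
    (hω : ∀ t ≤ T, (M.covOmega t).PosDef) :
    -- state and TRV are Gaussian, with nondegenerate TRV, and so is the state given the TRV
    (∀ t ≤ T,
      (M.stateCov t).PosSemidef ∧
      M.stateLaw t = multivariateGaussian (M.stateMean t) (M.stateCov t) ∧
      (M.trvCov t).PosDef ∧
      M.trvLaw t = multivariateGaussian (M.trvMean t) (M.trvCov t) ∧
      (M.condCov t).PosSemidef ∧
      ∀ z, M.stateGivenTRV t z = multivariateGaussian (M.condMean t z) (M.condCov t)) ∧
    -- the process and measurement models used by the Bayes filter are those of the induced system
    (∀ t < T, (M.induced.Q t).PosDef ∧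
      ∀ u z, M.nextTRVGivenTRV t u z = M.induced.trans t u z) ∧
    (∀ t ≤ T, (M.induced.R t).PosDef ∧
      ∀ z y, M.sensorGivenTRV t z y = M.induced.sensorDensity t z (M.inducedOutput t y)) ∧
    -- each process update is the Kalman process update
    (∀ t < T, ∀ (u : Vec m) (b : Vec k × Matrix (Fin k) (Fin k) ℝ), b.2.PosSemidef →
      (M.induced.kalmanPredict t u b).2.PosSemidef ∧
      M.bayesPredict t u (multivariateGaussian b.1 b.2) =
        multivariateGaussian (M.induced.kalmanPredict t u b).1
          (M.induced.kalmanPredict t u b).2) ∧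
    -- each measurement update is the Kalman measurement update
    (∀ t ≤ T, ∀ (y : Vec l) (b : Vec k × Matrix (Fin k) (Fin k) ℝ), b.2.PosSemidef →
      (M.induced.kalmanMeasurement t (M.inducedOutput t y) b).2.PosSemidef ∧
      M.bayesMeasurement t y (multivariateGaussian b.1 b.2) =
        multivariateGaussian (M.induced.kalmanMeasurement t (M.inducedOutput t y) b).1
          (M.induced.kalmanMeasurement t (M.inducedOutput t y) b).2) ∧
    -- hence, for all inputs and outputs, the Bayes filter is the Kalman filter
    (∀ (u : ℕ → Vec m) (y : ℕ → Vec l), ∀ t ≤ T,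
      (M.induced.kalmanPrior u (fun s => M.inducedOutput s (y s)) t).2.PosSemidef ∧
      M.belPrior u y t =
        multivariateGaussian
          (M.induced.kalmanPrior u (fun s => M.inducedOutput s (y s)) t).1
          (M.induced.kalmanPrior u (fun s => M.inducedOutput s (y s)) t).2 ∧
      (M.induced.kalmanPosterior u (fun s => M.inducedOutput s (y s)) t).2.PosSemidef ∧
      M.belPosterior u y t =
        multivariateGaussian
          (M.induced.kalmanPosterior u (fun s => M.inducedOutput s (y s)) t).1
          (M.induced.kalmanPosterior u (fun s => M.inducedOutput s (y s)) t).2) := by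
  have hη' : ∀ t < T, (M.covEta t).PosSemidef := fun t ht => (hη t ht.le).posSemidef
  have hlaw := fun t (ht : t ≤ T) => TRVModel.stateLaw_eq hx₀ hε hη' ht
  have hcov := fun t (ht : t ≤ T) => TRVModel.condCov_posSemidef (hlaw t ht).1 (hη t ht)
  have hcond := fun t (ht : t ≤ T) =>
    TRVModel.stateGivenTRV_eq (hlaw t ht).1 (hlaw t ht).2 (hη t ht)
  have hQ := fun t (ht : t < T) =>
    TRVModel.induced_Q_posDef (hcov t ht.le) (hε t ht) (hη (t + 1) ht)
  have htrans := fun t (ht : t < T) =>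
    TRVModel.nextTRVGivenTRV_eq (hcov t ht.le) (hcond t ht.le) (hε t ht) (hη (t + 1) ht)
  have hR := fun t (ht : t ≤ T) => TRVModel.induced_R_posDef (hcov t ht) (hω t ht)
  have hsensor := fun t (ht : t ≤ T) =>
    TRVModel.sensorGivenTRV_eq (hcov t ht) (hcond t ht) (hω t ht)
  have htrv := fun t (ht : t ≤ T) => TRVModel.trvLaw_eq (hlaw t ht).1 (hlaw t ht).2 (hη t ht)
  have htrvCov : ∀ t ≤ T, (M.trvCov t).PosDef := fun t ht =>
    (hlaw t ht).1.mul_mul_transpose_add_posDef _ (hη t ht)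
  have hpredict := fun t (ht : t < T) (u : Vec m) (b : Vec k × Matrix (Fin k) (Fin k) ℝ)
    (hb : b.2.PosSemidef) => TRVModel.bayesPredict_eq (htrans t ht) (hQ t ht) u hb
  have hmeas := fun t (ht : t ≤ T) (y : Vec l) (b : Vec k × Matrix (Fin k) (Fin k) ℝ)
    (hb : b.2.PosSemidef) => TRVModel.bayesMeasurement_eq (hsensor t ht) (hR t ht) y hb
  refine ⟨fun t ht => ⟨(hlaw t ht).1, (hlaw t ht).2, htrvCov t ht, htrv t ht, hcov t ht,
    hcond t ht⟩, fun t ht => ⟨hQ t ht, htrans t ht⟩, fun t ht => ⟨hR t ht, hsensor t ht⟩,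
    hpredict, hmeas, fun u y => ?_⟩
  -- Semidefiniteness is carried through the induction because both updates require it of the
  -- incoming covariance.
  have hprior : ∀ t ≤ T,
      (M.induced.kalmanPrior u (fun s => M.inducedOutput s (y s)) t).2.PosSemidef ∧
      M.belPrior u y t = multivariateGaussian
        (M.induced.kalmanPrior u (fun s => M.inducedOutput s (y s)) t).1
        (M.induced.kalmanPrior u (fun s => M.inducedOutput s (y s)) t).2 := by
    intro t
    induction t with
    | zero => exact fun ht => ⟨(htrvCov 0 ht).posSemidef, htrv 0 ht⟩
    | succ t ih =>
      intro ht
      obtain ⟨hb, hbel⟩ := ih (Nat.le_of_succ_le ht)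
      obtain ⟨hb', hbel'⟩ := hmeas t (Nat.le_of_succ_le ht) (y t) _ hb
      rw [TRVModel.belPrior, LGSystem.kalmanPrior, hbel, hbel']
      exact hpredict t ht (u t) _ hb'
  intro t ht
  obtain ⟨hb, hbel⟩ := hprior t ht
  refine ⟨hb, hbel, ?_⟩
  rw [TRVModel.belPosterior, hbel]
  exact hmeas t ht (y t) _ hb
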